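/- **Theorem 1.4.** Let $D$ be a connected link diagram with at least one crossing (connected means that the projection graph, obtained from $D$ by turning each crossing into a 4-valent vertex, is connected). Suppose that $D$ is reduced, that is, no crossing meets a region of $D$ (a complementary region of the projection graph) more than once. Let the regions of $D$ be checkerboard-colored black and white, so that at each crossing two opposite regions are black and the other two are white, and let $G$ be the Tait graph: the multigraph whose vertices are the black regions and which has one edge for each crossing, joining the black regions at the two opposite black corners of that crossing. A state $\sigma$ of $D$ is a choice of the A- or the B-resolution at each crossing. Resolving all crossings according to $\sigma$ turns $D$ into a disjoint collection of state circles, with one state segment for each crossing, which connects the two arcs that replace that crossing. The state $\sigma$ is called $\sigma$-adequate if no state segment connects a state circle to itself. The black (respectively white) checkerboard state is the state in which the crossings are resolved so that the state circles are, up to small perturbation, the boundaries of the black (respectively white) regions. Then both the black and the white checkerboard state of $D$ are $\sigma$-adequate, and the number $N$ of $\sigma$-adequate states of $D$ satisfies $$2 \;\le\; N \;\le\; \#\{\text{spanning trees of } G\}.$$ -/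

import Mathlib

namespace Graph

variable {α β : Type*}

/-- A multigraph is connected if it has a vertex and any two of its vertices are joined by a
finite sequence of edges. -/
def IsConnected (G : Graph α β) : Prop :=
  G.vertexSet.Nonempty ∧ ∀ u ∈ G.vertexSet, ∀ v ∈ G.vertexSet,
    Relation.ReflTransGen (fun a b => ∃ e, G.IsLink e a b) u v

/-- The edges `e 0, …, e n` and the vertices `v 0, …, v n` form a cycle with `n + 1` edges: the
vertices are distinct, the edges are distinct, and `e i` joins `v i` to `v (i + 1)`, where the
indices are added cyclically. A loop is a cycle with one edge, and two parallel edges form a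
cycle with two edges. -/
def IsCycle (G : Graph α β) {n : ℕ} (v : Fin (n + 1) → α) (e : Fin (n + 1) → β) : Prop :=
  Function.Injective v ∧ Function.Injective e ∧ ∀ i, G.IsLink (e i) (v i) (v (i + 1))

/-- A tree is a connected multigraph without cycles. -/
def IsTree (G : Graph α β) : Prop :=
  G.IsConnected ∧ ∀ (n : ℕ) (v : Fin (n + 1) → α) (e : Fin (n + 1) → β), ¬ G.IsCycle v e

/-- The spanning trees of `G`: the subgraphs of `G` that contain every vertex of `G` and
are trees. -/
def spanningTrees (G : Graph α β) : Set (Graph α β) :=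
  {T | T.IsSpanningSubgraph G ∧ T.IsTree}

end Graph

/-- A planar diagram code on the set `X` of crossings, before planarity is imposed.

Each crossing `x` has four half-edges `(x, 0), (x, 1), (x, 2), (x, 3)`, listed in counterclockwise
order. The half-edges `0` and `2` lie on the strand that passes under, the half-edges
`1` and `3` on the strand that passes over. The involution `arc` sends each half-edge to the
half-edge at the other end of the arc of the diagram on which it lies. -/
structure PDCode (X : Type*) where
  arc : X × Fin 4 → X × Fin 4
  arc_arc : ∀ h, arc (arc h) = h
  arc_ne : ∀ h, arc h ≠ h

namespace PDCode

variable {X : Type*} (D : PDCode X)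

/-- The corner `(x, i)` is the sector at the crossing `x` between the half-edge `(x, i)` and the
next half-edge counterclockwise, `(x, i + 1)`. The permutation `turn` takes each corner to the next
corner of the same region: leave `x` along the half-edge `(x, i)`, with the region on the left,
arrive at the half-edge `(y, j) = arc (x, i)`; the region on the left is now at the corner
`(y, j - 1)`. -/
def turn : Equiv.Perm (X × Fin 4) where
  toFun h := ((D.arc h).1, (D.arc h).2 - 1)
  invFun h := D.arc (h.1, h.2 + 1)
  left_inv h := by simp [D.arc_arc]
  right_inv h := by simp [D.arc_arc]

/-- The regions (complementary regions of the projection graph) are the cycles of the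
permutation `turn` of the corners. -/
def Region : Type _ := Quotient (Equiv.Perm.SameCycle.setoid D.turn)

/-- The region that contains a given corner. -/
def region (h : X × Fin 4) : D.Region := Quotient.mk (Equiv.Perm.SameCycle.setoid D.turn) h

/-- Two crossings are adjacent in the projection graph if an arc of the diagram joins them. -/
def Adj (x y : X) : Prop := ∃ i j, D.arc (x, i) = (y, j)

/-- The connected components of the projection graph. -/
def Component : Type _ := Quot D.Adj

end PDCode

/-- A link diagram (with set of crossings `X`, all of whose components meet a crossing), as a
planar diagram code. Planarity is Euler's formula for the projection graph, which has
`|X|` vertices and `2|X|` edges: drawing each connected component on a sphere of its own,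
`|X| - 2|X| + #regions = 2 · #components`. (For a connected diagram the regions are
those of the diagram in the sphere, or equivalently in the plane.) -/
structure LinkDiagram (X : Type*) extends PDCode X where
  planar : Nat.card toPDCode.Region = Nat.card X + 2 * Nat.card toPDCode.Component

/-- The two ways to resolve a crossing. -/
inductive Resolution
  | A
  | B

/-- Resolving a crossing replaces it by two disjoint arcs, each of which joins two cyclically
consecutive half-edges. The A-resolution merges the two regions that are swept out when the
overstrand (half-edges `1` and `3`) is rotated counterclockwise, that is, the corners `1` and `3`;
hence its arcs join `0` with `1` and `2` with `3`. The B-resolution merges the corners `0` and `2`;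
its arcs join `1` with `2` and `3` with `0`. -/
def Resolution.partner : Resolution → Fin 4 → Fin 4
  | .A => ![1, 0, 3, 2]
  | .B => ![3, 2, 1, 0]

namespace LinkDiagram

variable {X : Type*} (D : LinkDiagram X)

/-- The diagram is connected if its projection graph is: any two crossings are joined by a chain
of arcs. -/
def IsConnected : Prop := ∀ x y, Relation.ReflTransGen D.Adj x y

/-- A crossing is nugatory if it meets a region more than once. -/
def IsNugatory (x : X) : Prop := ∃ i j : Fin 4, i ≠ j ∧ D.region (x, i) = D.region (x, j)

/-- A diagram is reduced if it has no nugatory crossing. -/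
def IsReduced : Prop := ∀ x, ¬ D.IsNugatory x

/-- A state chooses an A- or B-resolution at each crossing. -/
def State (_ : LinkDiagram X) : Type _ := X → Resolution

/-- The state circles of the state `σ`: the closed curves formed from the arcs of the diagram and
the two arcs that replace each crossing, given as classes of half-edges. -/
def StateCircle (σ : D.State) : Type _ :=
  Quot fun h k : X × Fin 4 => k = D.arc h ∨ k = (h.1, (σ h.1).partner h.2)

/-- The state circle that contains a given half-edge. -/
def stateCircle (σ : D.State) (h : X × Fin 4) : D.StateCircle σ := Quot.mk _ h

/-- The state `σ` is a σ-adequate state: no state segment connects a state circle to itself. The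
state segment at the crossing `x` connects the two arcs that replace `x`. For either resolution
the half-edges `(x, 0)` and `(x, 2)` lie one on each of these arcs. -/
def IsAdequate (σ : D.State) : Prop :=
  ∀ x, D.stateCircle σ (x, 0) ≠ D.stateCircle σ (x, 2)

/-- A checkerboard coloring shades each region black or white so that at each crossing neighboring
corners have different colors; thus two opposite corners are black and the other two
are white. -/
structure Checkerboard where
  isBlack : D.Region → Bool
  alternates : ∀ x i, isBlack (D.region (x, i + 1)) = !isBlack (D.region (x, i))

namespace Checkerboard

variable {D} (C : D.Checkerboard)

/-- The black checkerboard state: each crossing is resolved so that, at each of its black corners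
`(x, i)`, the half-edges `(x, i)` and `(x, i + 1)` are joined along the boundary of the black region.
If the corners `0` and `2` are black then this is the A-resolution, otherwise the
B-resolution. The state circles are then the boundaries of the black regions. -/
def blackState : D.State := fun x =>
  if C.isBlack (D.region (x, 0)) then Resolution.A else Resolution.B

/-- The white checkerboard state: each crossing is resolved along its white corners. -/
def whiteState : D.State := fun x =>
  if C.isBlack (D.region (x, 0)) then Resolution.B else Resolution.A

/-- The Tait graph: the vertices are the black regions, the edges are the crossings, and the
crossing `x` joins the regions at its two black corners (a loop if these
coincide). -/
def taitGraph : Graph D.Region X where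
  vertexSet := {r | C.isBlack r = true}
  IsLink x r s := ∃ i : Fin 4, C.isBlack (D.region (x, i)) = true ∧
    r = D.region (x, i) ∧ s = D.region (x, i + 2)
  isLink_symm := by
    intro x _
    constructor
    rintro r s ⟨i, hi, rfl, rfl⟩
    refine ⟨i + 2, ?_, rfl, ?_⟩
    · have h1 := C.alternates x i
      have h2 := C.alternates x (i + 1)
      rw [h1, hi, add_assoc] at h2
      exact h2
    · rw [add_assoc, show (2 + 2 : Fin 4) = 0 from rfl, add_zero]
  eq_or_eq_of_isLink_of_isLink := by
    rintro x r s t u ⟨i, hi, rfl, rfl⟩ ⟨j, hj, rfl, rfl⟩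
    have key : j = i ∨ j = i + 1 ∨ j = i + 2 ∨ i = j + 1 := by
      have aux : ∀ i j : Fin 4, j = i ∨ j = i + 1 ∨ j = i + 2 ∨ i = j + 1 := by decide
      exact aux i j
    rcases key with rfl | rfl | rfl | rfl
    · exact Or.inl rfl
    · simp [C.alternates, hi] at hj
    · right
      rw [add_assoc, show (2 + 2 : Fin 4) = 0 from rfl, add_zero]
    · simp [C.alternates, hj] at hi
  left_mem_of_isLink := by
    rintro x r s ⟨i, hi, rfl, rfl⟩
    exact hi

end Checkerboard

end LinkDiagram

/-! Work in the cycle matroid of the Tait graph, represented over `ZMod 2` by incidence vectors; its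
bases are the spanning trees. Encode a state by the set `S` of crossings where it differs from the
black state, that is, where it merges the two black corners.

If the state is adequate, `S` is a cyclic flat (`IsAdequate.isCyclicFlat`). By planarity, a state
circle is the boundary modulo 2 of a set of regions. For a circle through a given crossing, adequacy
makes the indicator of this set differ at the two unmerged corners there, while it agrees at merged
corners everywhere (`IsAdequate.exists_regions`). For a crossing outside `S`, the indicator on black
regions gives a cut through it that misses `S`, so `S` does not span it. For a crossing in `S`, the
indicator on white regions gives a cut of the dual graph, hence a cycle modulo 2 through it inside
`S`.

A represented matroid on a finite set has at most as many cyclic flats as bases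
(`exists_injOn_cyclicFlats`): a greedy basis, for an order adapted to `S`, determines `S`. This
gives the upper bound. For the lower bound, reducedness makes both checkerboard states adequate, and
they differ at every crossing. -/

/-! ### Cyclic flats and bases of a vector family -/

section CyclicFlats

variable {K V X : Type*} [DivisionRing K] [AddCommGroup V] [Module K V]

open Submodule

/-- A set `S` of indices is a cyclic flat of the family `v` if it contains every index whose vector
lies in the span of `S`, and each of its vectors lies in the span of the others. -/
def IsCyclicFlat (K : Type*) {V X : Type*} [DivisionRing K] [AddCommGroup V] [Module K V]
    (v : X → V) (S : Set X) : Prop :=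
  (∀ e ∈ S, v e ∈ span K (v '' (S \ {e}))) ∧ ∀ e ∉ S, v e ∉ span K (v '' S)

/-- A set `B` of indices is a basis of the family `v` if its vectors span all vectors of the family
and none of them lies in the span of the others. -/
def IsFamilyBasis (K : Type*) {V X : Type*} [DivisionRing K] [AddCommGroup V] [Module K V]
    (v : X → V) (B : Set X) : Prop :=
  (∀ x, v x ∈ span K (v '' B)) ∧ ∀ b ∈ B, v b ∉ span K (v '' (B \ {b}))

lemma mem_span_image_mono {v : X → V} {w : V} {A A' : Set X} (hw : w ∈ span K (v '' A))
    (h : ∀ a ∈ A, a ∈ A') : w ∈ span K (v '' A') :=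
  span_mono (Set.image_mono h) hw

lemma exists_minimal_spanning_subset [Finite X] (v : X → V) {w : V} {A : Set X}
    (h : w ∈ span K (v '' A)) :
    ∃ T ⊆ A, w ∈ span K (v '' T) ∧ ∀ g ∈ T, w ∉ span K (v '' (T \ {g})) := by
  obtain ⟨T, hTA, hT⟩ := exists_minimal_le_of_wellFoundedLT
    (fun T : Set X => w ∈ span K (v '' T)) A h
  refine ⟨T, hTA, hT.1, fun g hg hw => ?_⟩
  exact (hT.2 hw Set.sdiff_subset hg).2 rfl

lemma mem_span_image_insert_diff {v : X → V} {e g : X} {T : Set X} (hg : g ∈ T)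
    (h : v e ∈ span K (v '' T)) (h' : v e ∉ span K (v '' (T \ {g}))) :
    v g ∈ span K (v '' insert e (T \ {g})) := by
  rw [Set.image_insert_eq]
  refine mem_span_insert_exchange ?_ h'
  rwa [← Set.image_insert_eq, Set.insert_sdiff_singleton, Set.insert_eq_of_mem hg]

/-- The greedy algorithm: for every linear order of the indices there is a basis such
that every vector is spanned by basis vectors that do not come later. -/
lemma exists_greedy_basis [Finite X] {α : Type*} [LinearOrder α] (v : X → V) (r : X → α)
    (hr : Function.Injective r) :
    ∃ B : Set X, (∀ x, v x ∈ span K (v '' {b ∈ B | r b ≤ r x})) ∧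
      ∀ b ∈ B, v b ∉ span K (v '' (B \ {b})) := by
  refine ⟨{b | v b ∉ span K (v '' {a | r a < r b})}, fun x => ?_, fun b hb hspan => ?_⟩
  · have wf : WellFounded (InvImage (· < ·) r) := Finite.wellFounded_of_trans_of_irrefl _
    induction x using wf.induction with
    | _ x ih =>
      by_cases hx : v x ∈ span K (v '' {a | r a < r x})
      · refine span_le.2 ?_ hx
        rintro _ ⟨a, ha, rfl⟩
        refine span_mono (Set.image_mono ?_) (ih a ha)
        exact fun b hb => ⟨hb.1, hb.2.trans (le_of_lt ha)⟩
      · exact subset_span ⟨x, ⟨hx, le_rfl⟩, rfl⟩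
  -- In a minimal dependency the last element is spanned by earlier ones, so the greedy algorithm
  -- would have rejected it.
  · obtain ⟨T, hTB, hbT, hmin⟩ := exists_minimal_spanning_subset v hspan
    obtain ⟨m, hm, hmax⟩ := Set.exists_max_image (insert b T) r (Set.toFinite _)
      ⟨b, Set.mem_insert _ _⟩
    have hlt : ∀ a ∈ insert b T, a ≠ m → r a < r m := fun a ha hne =>
      lt_of_le_of_ne (hmax a ha) (hr.ne hne)
    rcases eq_or_ne m b with rfl | hmb
    · refine hb (span_mono (Set.image_mono fun a ha => ?_) hbT)
      exact hlt a (Set.mem_insert_of_mem _ ha) (hTB ha).2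
    · have hmT : m ∈ T := hm.resolve_left hmb
      refine (hTB hmT).1 (span_mono (Set.image_mono ?_)
        (mem_span_image_insert_diff hmT hbT (hmin m hmT)))
      rintro a (rfl | ha)
      · exact hlt a (Set.mem_insert _ _) hmb.symm
      · exact hlt a (Set.mem_insert_of_mem _ ha.1) ha.2

/-- A basis is compatible with the set `S` of indices if it contains a basis of `S`,
if each of its elements in `S` can be exchanged for a smaller element of `S`, and if every
index outside of `S` and the basis can be exchanged for a smaller element outside of `S`. -/
structure IsCompatibleBasis (K : Type*) {V X : Type*} [DivisionRing K] [AddCommGroup V]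
    [Module K V] [LinearOrder X] (v : X → V) (S B : Set X) : Prop where
  isBasis : IsFamilyBasis K v B
  mem_span : ∀ x ∈ S, v x ∈ span K (v '' (B ∩ S))
  exchange : ∀ b ∈ B, b ∈ S → ∃ f ∈ S, f < b ∧ v f ∉ span K (v '' (B \ {b}))
  exchange' : ∀ e ∉ B, e ∉ S → ∃ g ∈ B, g ∉ S ∧ g < e ∧ v e ∉ span K (v '' (B \ {g}))

/-- Greedy choice works for the order that lists `S` first, decreasingly, and then the complement,
increasingly. Cyclicity supplies the exchanges inside `S`, flatness those outside. -/
lemma IsCyclicFlat.exists_isCompatibleBasis [Finite X] [LinearOrder X] {v : X → V} {S : Set X}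
    (hS : IsCyclicFlat K v S) : ∃ B, IsCompatibleBasis K v S B := by
  classical
  let r : X → Xᵒᵈ ⊕ₗ X := fun x =>
    if x ∈ S then toLex (Sum.inl (OrderDual.toDual x)) else toLex (Sum.inr x)
  have r_pos : ∀ {x}, x ∈ S → r x = toLex (Sum.inl (OrderDual.toDual x)) := fun h => if_pos h
  have r_neg : ∀ {x}, x ∉ S → r x = toLex (Sum.inr x) := fun h => if_neg h
  have hr : Function.Injective r := by
    intro x y h
    by_cases hx : x ∈ S <;> by_cases hy : y ∈ S <;>
      simp_all
  have hle : ∀ {a x}, x ∈ S → r a ≤ r x → a ∈ S ∧ x ≤ a := by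
    intro a x hx h
    by_cases ha : a ∈ S
    · rw [r_pos hx, r_pos ha] at h
      exact ⟨ha, by simpa using h⟩
    · rw [r_pos hx, r_neg ha] at h
      simp at h
  have hle' : ∀ {a x}, a ∉ S → r a ≤ r x → a ≤ x := by
    intro a x ha h
    by_cases hx : x ∈ S
    · exact absurd (hle hx h).1 ha
    · rw [r_neg hx, r_neg ha] at h
      simpa using h
  obtain ⟨B, hspan, hind⟩ := exists_greedy_basis (K := K) v r hr
  refine ⟨B, ⟨fun x => mem_span_image_mono (hspan x) fun b hb => hb.1, hind⟩,
    fun x hx => mem_span_image_mono (hspan x) fun b hb => ⟨hb.1, (hle hx hb.2).1⟩,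
    fun b hb hbS => ?_, fun e he heS => ?_⟩
  · obtain ⟨f, hf, hfb⟩ : ∃ f ∈ S \ {b}, v f ∉ span K (v '' (B \ {b})) := by
      by_contra! h
      refine hind b hb (span_le.2 ?_ (hS.1 b hbS))
      rintro _ ⟨f, hf, rfl⟩
      exact h f hf
    refine ⟨f, hf.1, lt_of_le_of_ne ?_ hf.2, hfb⟩
    -- If `b < f`, then `b` comes after `f` in the order `r`, so the greedy expansion of `f` avoids
    -- `b`.
    by_contra hlt
    refine hfb (mem_span_image_mono (hspan f) fun a ha => ⟨ha.1, ?_⟩)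
    rintro rfl
    exact hlt (hle hf.1 ha.2).2
  · obtain ⟨T, hTB, heT, hmin⟩ := exists_minimal_spanning_subset v (hspan e)
    -- Otherwise `T` lies in `S`, and the flat `S` would contain `e`.
    obtain ⟨g, hgT, hgS⟩ : ∃ g ∈ T, g ∉ S := by
      by_contra! h
      exact hS.2 e heS (span_mono (Set.image_mono h) heT)
    refine ⟨g, (hTB hgT).1, hgS, lt_of_le_of_ne (hle' hgS (hTB hgT).2) ?_, fun h => ?_⟩
    · rintro rfl
      exact he (hTB hgT).1
    · refine hind g (hTB hgT).1 (span_le.2 ?_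
        (mem_span_image_insert_diff hgT heT (hmin g hgT)))
      rintro _ ⟨a, rfl | ha, rfl⟩
      · exact h
      · exact subset_span ⟨a, ⟨(hTB ha.1).1, ha.2⟩, rfl⟩

/-- If `e` is in `B`, its smaller replacement in `S` also lies in `S'`, so it is spanned by `B ∩
S'`, which omits `e`. If not, the smaller `g` given by `S'` is also outside `S`, so `B ∩ S` spans
`e` without `g`. Both contradict the exchange. -/
lemma IsCompatibleBasis.notMem_diff [LinearOrder X] {v : X → V} {S S' B : Set X}
    (h : IsCompatibleBasis K v S B) (h' : IsCompatibleBasis K v S' B) {e : X}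
    (hmin : ∀ f < e, f ∈ S ↔ f ∈ S') : e ∉ S \ S' := by
  rintro ⟨heS, heS'⟩
  by_cases heB : e ∈ B
  · obtain ⟨f, hf, hfe, hfB⟩ := h.exchange e heB heS
    refine hfB (mem_span_image_mono (h'.mem_span f ((hmin f hfe).1 hf))
      fun b hb => ⟨hb.1, ?_⟩)
    rintro rfl
    exact heS' hb.2
  · obtain ⟨g, hgB, hg, hge, hspan⟩ := h'.exchange' e heB heS'
    refine hspan (mem_span_image_mono (h.mem_span e heS) fun b hb => ⟨hb.1, ?_⟩)
    rintro rfl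
    exact hg ((hmin _ hge).1 hb.2)

lemma IsCompatibleBasis.eq [Finite X] [LinearOrder X] {v : X → V} {S S' B : Set X}
    (h : IsCompatibleBasis K v S B) (h' : IsCompatibleBasis K v S' B) : S = S' := by
  ext e
  induction e using (wellFounded_lt (α := X)).induction with
  | _ e ih =>
    have h1 := h.notMem_diff h' ih
    have h2 := h'.notMem_diff h fun f hf => (ih f hf).symm
    simp only [Set.mem_sdiff] at h1 h2
    tauto

/-- There are at most as many cyclic flats as bases. -/
theorem exists_injOn_cyclicFlats [Finite X] (v : X → V) :
    ∃ F : Set X → Set X, (∀ S, IsCyclicFlat K v S → IsFamilyBasis K v (F S)) ∧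
      Set.InjOn F {S | IsCyclicFlat K v S} := by
  obtain ⟨n, ⟨i⟩⟩ := Finite.exists_equiv_fin X
  let _ : LinearOrder X := LinearOrder.lift' i i.injective
  choose! F hF using fun (S : Set X) (hS : IsCyclicFlat K v S) => hS.exists_isCompatibleBasis
  exact ⟨F, fun S hS => (hF S hS).isBasis,
    fun S hS S' hS' h => (hF S hS).eq (h ▸ hF S' hS')⟩

end CyclicFlats

/-! ### Incidence vectors modulo 2 and spanning trees -/

namespace Graph

variable {α β : Type*} (G : Graph α β)

open Submodule

open Classical in
/-- The incidence vector modulo 2 of an edge. -/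
noncomputable def incVec (e : β) : α →₀ ZMod 2 :=
  if h : ∃ p : α × α, G.IsLink e p.1 p.2 then
    Finsupp.single h.choose.1 1 + Finsupp.single h.choose.2 1
  else 0

variable {G}

lemma IsLink.incVec_eq {e : β} {x y : α} (h : G.IsLink e x y) :
    G.incVec e = Finsupp.single x 1 + Finsupp.single y 1 := by
  have hex : ∃ p : α × α, G.IsLink e p.1 p.2 := ⟨(x, y), h⟩
  rw [incVec, dif_pos hex]
  obtain ⟨h1, h2⟩ | ⟨h1, h2⟩ := hex.choose_spec.eq_and_eq_or_eq_and_eq h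
  · rw [h1, h2]
  · rw [h1, h2, add_comm]

lemma IsLink.linearCombination_incVec {e : β} {x y : α} (h : G.IsLink e x y) (φ : α → ZMod 2) :
    Finsupp.linearCombination (ZMod 2) φ (G.incVec e) = φ x + φ y := by
  simp [h.incVec_eq]

lemma IsCycle.sum_incVec {n : ℕ} {v : Fin (n + 1) → α} {e : Fin (n + 1) → β}
    (h : G.IsCycle v e) : ∑ i, G.incVec (e i) = 0 := by
  have hs : ∑ i, (Finsupp.single (v (i + 1)) 1 : α →₀ ZMod 2) = ∑ i, Finsupp.single (v i) 1 :=
    Equiv.sum_comp (Equiv.addRight (1 : Fin (n + 1)))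
      fun i => (Finsupp.single (v i) 1 : α →₀ ZMod 2)
  simp_rw [fun i => (h.2.2 i).incVec_eq, Finset.sum_add_distrib, hs]
  exact ZModModule.add_self _

lemma IsConnected.restrict_of_isFamilyBasis (hG : G.IsConnected) {B : Set β}
    (hB : IsFamilyBasis (ZMod 2) G.incVec B) : (G.restrict B).IsConnected := by
  classical
  refine ⟨hG.1, fun u hu w hw => ?_⟩
  let R : α → Prop := Relation.ReflTransGen (fun a b => ∃ e, (G.restrict B).IsLink e a b) u
  -- The indicator of a component of `B`, as a functional, kills the vectors of `B` and hence those
  -- of all edges. So no edge of `G` leaves the component.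
  let φ : α → ZMod 2 := fun a => if R a then 1 else 0
  have hstep : ∀ e x y, G.IsLink e x y → φ x = φ y := by
    have hker : ∀ e, G.incVec e ∈ LinearMap.ker (Finsupp.linearCombination (ZMod 2) φ) := by
      intro e
      refine span_le.2 ?_ (hB.1 e)
      rintro _ ⟨b, hb, rfl⟩
      by_cases hex : ∃ p : α × α, G.IsLink b p.1 p.2
      · obtain ⟨⟨x, y⟩, hxy⟩ := hex
        have hiff : R x ↔ R y :=
          ⟨fun h => h.tail ⟨b, by simp [hb, hxy]⟩, fun h => h.tail ⟨b, by simp [hb, hxy.symm]⟩⟩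
        simp [hxy.linearCombination_incVec, φ, hiff, CharTwo.add_self_eq_zero]
      · simp [incVec, hex]
    intro e x y h
    have := hker e
    rwa [LinearMap.mem_ker, h.linearCombination_incVec, CharTwo.add_eq_zero] at this
  have hconst : φ u = φ w := by
    have := hG.2 u hu w hw
    induction this with
    | refl => rfl
    | tail _ hbc ih =>
      obtain ⟨e, he⟩ := hbc
      exact (ih he.left_mem).trans (hstep _ _ _ he)
  by_contra hnot
  have h1 : φ u = 1 := if_pos Relation.ReflTransGen.refl
  have h0 : φ w = 0 := if_neg hnot
  rw [h1, h0] at hconst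
  exact one_ne_zero hconst

/-- A set of edges whose incidence vectors form a basis is the set of edges of
a spanning tree. -/
theorem IsConnected.restrict_mem_spanningTrees (hG : G.IsConnected) {B : Set β}
    (hB : IsFamilyBasis (ZMod 2) G.incVec B) : G.restrict B ∈ G.spanningTrees := by
  refine ⟨⟨restrict_le .., rfl⟩, hG.restrict_of_isFamilyBasis hB, fun n v e hc => ?_⟩
  have hB' : ∀ i, e i ∈ B := fun i => (by simpa using hc.2.2 i : e i ∈ B ∧ _).1
  have hc' : G.IsCycle v e := ⟨hc.1, hc.2.1, fun i => (hc.2.2 i).mono (restrict_le ..)⟩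
  have hsum := hc'.sum_incVec
  -- The relation around the cycle expresses one edge through the others, against independence. For
  -- a loop the remaining sum is empty.
  rw [← Finset.add_sum_erase _ _ (Finset.mem_univ (0 : Fin (n + 1))),
    ← ZModModule.sub_eq_add, sub_eq_zero] at hsum
  refine hB.2 _ (hB' 0) (hsum ▸ sum_mem fun i hi => subset_span ⟨e i, ⟨hB' i, ?_⟩, rfl⟩)
  exact fun h => (Finset.mem_erase.1 hi).1 (hc.2.1 h)

/-- Needed because `Set.ncard` is zero on infinite sets. A spanning subgraph is determined by its
edges. -/
lemma finite_spanningTrees [Finite α] [Finite β] (G : Graph α β) : G.spanningTrees.Finite := by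
  refine Set.Finite.of_injOn (f := Graph.edgeSet) (t := Set.univ) (fun _ _ => trivial) ?_
    Set.finite_univ
  intro T hT T' hT' h
  exact (Compatible.of_le_le hT.1.le hT'.1.le).ext
    (hT.1.vertexSet_eq.trans hT'.1.vertexSet_eq.symm) h

end Graph

/-! ### Homology modulo 2 of the projection graph -/

namespace PDCode

variable {X : Type*} (D : PDCode X)

instance [Finite X] : Finite D.Region :=
  inferInstanceAs (Finite (Quotient (Equiv.Perm.SameCycle.setoid D.turn)))

lemma region_turn (p : X × Fin 4) : D.region (D.turn p) = D.region p :=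
  Quotient.sound (s := Equiv.Perm.SameCycle.setoid D.turn)
    (Equiv.Perm.sameCycle_apply_left.2 (Equiv.Perm.SameCycle.refl _ _))

lemma region_arc (h : X × Fin 4) : D.region (D.arc h) = D.region (h.1, h.2 - 1) := by
  rw [← D.region_turn]
  simp [turn, D.arc_arc]

lemma region_eq_arc (h : X × Fin 4) :
    D.region h = D.region ((D.arc h).1, (D.arc h).2 - 1) := by
  rw [← D.region_arc, D.arc_arc]

/-- The arcs lead each half-edge to a crossing in the same connected component, so a function
of the regions that does not change across arcs is constant if the diagram is
connected. -/
lemma eq_of_constant_across_arcs (hconn : ∀ x y, Relation.ReflTransGen D.Adj x y) {K : Type*}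
    (c : D.Region → K) (hc : ∀ x i, c (D.region (x, i)) = c (D.region (x, i - 1)))
    (r s : D.Region) : c r = c s := by
  have hx : ∀ x (i : Fin 4), c (D.region (x, i)) = c (D.region (x, 0)) := by
    intro x i
    have h1 := hc x 1
    have h2 := hc x 2
    have h3 := hc x 3
    fin_cases i
    · rfl
    · exact h1
    · exact h2.trans h1
    · exact h3.trans (h2.trans h1)
  have key : ∀ x y, c (D.region (x, 0)) = c (D.region (y, 0)) := by
    intro x y
    induction hconn x y with
    | refl => rfl
    | @tail y z _ hyz ih =>
      obtain ⟨i, j, hij⟩ := hyz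
      have := D.region_arc (y, i)
      rw [hij] at this
      rw [ih, ← hx y (i - 1), ← hx z j, this]
  induction r using Quotient.inductionOn with | _ p =>
  induction s using Quotient.inductionOn with | _ q =>
  exact (hx p.1 p.2).trans ((key p.1 q.1).trans (hx q.1 q.2).symm)

/-- Adds to each function on the half-edges its composition with `arc`. The kernel
consists of the functions on the arcs, that is, of the 1-chains modulo 2 of the projection graph. -/
def arcSum : (X × Fin 4 → ZMod 2) →ₗ[ZMod 2] (X × Fin 4 → ZMod 2) :=
  LinearMap.id + LinearMap.funLeft _ _ D.arc

lemma mem_ker_arcSum {ψ : X × Fin 4 → ZMod 2} :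
    ψ ∈ LinearMap.ker D.arcSum ↔ ∀ h, ψ (D.arc h) = ψ h := by
  simp only [LinearMap.mem_ker, funext_iff, arcSum, LinearMap.add_apply, LinearMap.id_apply,
    LinearMap.funLeft_apply, Pi.add_apply, Pi.zero_apply, CharTwo.add_eq_zero]
  exact forall_congr' fun h => eq_comm

/-- The boundary map modulo 2 from the 1-chains of the projection graph to its 0-chains. -/
def boundary : LinearMap.ker D.arcSum →ₗ[ZMod 2] (X → ZMod 2) :=
  LinearMap.domRestrict
    { toFun := fun ψ x => ∑ i, ψ (x, i)
      map_add' := fun ψ χ => by ext; simp [Finset.sum_add_distrib]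
      map_smul' := fun a ψ => by ext; simp [Finset.mul_sum] } _

lemma boundary_apply (ψ : LinearMap.ker D.arcSum) (x : X) :
    D.boundary ψ x = ∑ i, ψ.1 (x, i) := rfl

/-- The boundary map modulo 2 from the 2-chains to the 1-chains of the projection graph: an
arc lies in the boundary if exactly one of its two sides belongs to the 2-chain. -/
def regionBoundary : (D.Region → ZMod 2) →ₗ[ZMod 2] LinearMap.ker D.arcSum :=
  LinearMap.codRestrict _
    { toFun := fun c h => c (D.region h) + c (D.region (h.1, h.2 - 1))
      map_add' := fun c d => by ext; simp only [Pi.add_apply]; ring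
      map_smul' := fun a c => by ext; simp [mul_add] }
    fun c => by
      rw [mem_ker_arcSum]
      intro h
      simp only [LinearMap.coe_mk, AddHom.coe_mk]
      rw [← D.region_eq_arc, D.region_arc, add_comm]

lemma regionBoundary_apply (c : D.Region → ZMod 2) (h : X × Fin 4) :
    (D.regionBoundary c).1 h = c (D.region h) + c (D.region (h.1, h.2 - 1)) := rfl

lemma range_regionBoundary_le : LinearMap.range D.regionBoundary ≤ LinearMap.ker D.boundary := by
  rintro _ ⟨c, rfl⟩
  ext x
  simp only [boundary_apply, regionBoundary_apply, Finset.sum_add_distrib, Pi.zero_apply]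
  have hs : ∑ i, c (D.region (x, i - 1)) = ∑ i, c (D.region (x, i)) :=
    Equiv.sum_comp (Equiv.subRight (1 : Fin 4)) fun i => c (D.region (x, i))
  rw [hs]
  exact CharTwo.add_self_eq_zero _

lemma finrank_ker_arcSum_le [Fintype X] :
    Module.finrank (ZMod 2) (LinearMap.ker D.arcSum) ≤ 2 * Fintype.card X := by
  obtain ⟨n, ⟨f⟩⟩ := Finite.exists_equiv_fin (X × Fin 4)
  have hle : LinearMap.ker D.arcSum ≤ LinearMap.range D.arcSum := by
    intro ψ hψ
    rw [mem_ker_arcSum] at hψ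
    -- The numbering `f` selects one half-edge of each arc. Keeping `ψ` only there gives a preimage;
    -- then the kernel has at most half of the total dimension `4|X|`.
    refine ⟨fun h => if f h < f (D.arc h) then ψ h else 0, ?_⟩
    ext h
    have hne : f (D.arc h) ≠ f h := f.injective.ne (D.arc_ne h)
    simp only [arcSum, LinearMap.add_apply, LinearMap.id_apply, LinearMap.funLeft_apply,
      Pi.add_apply, D.arc_arc, hψ h]
    rcases lt_or_gt_of_ne hne with h1 | h1
    · simp [h1, h1.not_gt]
    · simp [h1, h1.not_gt]
  have h1 := LinearMap.finrank_range_add_finrank_ker D.arcSum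
  have h2 := Submodule.finrank_mono hle
  simp at h1
  omega

/-- The boundary of an arc is the sum of its endpoints, so by connectedness all vertices agree
modulo boundaries. -/
lemma card_le_finrank_range_boundary [Fintype X] [Nonempty X]
    (hconn : ∀ x y, Relation.ReflTransGen D.Adj x y) :
    Fintype.card X ≤ Module.finrank (ZMod 2) (LinearMap.range D.boundary) + 1 := by
  classical
  obtain ⟨x₀⟩ := ‹Nonempty X›
  let δ : X → X → ZMod 2 := fun x => Pi.single x 1
  have hδ : ∀ x, δ x ∈ LinearMap.range D.boundary ⊔ Submodule.span (ZMod 2) {δ x₀} := by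
    intro x
    induction hconn x₀ x with
    | refl => exact Submodule.mem_sup_right (Submodule.mem_span_singleton_self _)
    | @tail y z _ hyz ih =>
      obtain ⟨i, j, hij⟩ := hyz
      let ψ : X × Fin 4 → ZMod 2 := Pi.single (y, i) 1 + Pi.single (z, j) 1
      have hψ : ψ ∈ LinearMap.ker D.arcSum := by
        rw [mem_ker_arcSum]
        intro h
        have hji : D.arc (z, j) = (y, i) := by rw [← hij, D.arc_arc]
        have e1 : D.arc h = (y, i) ↔ h = (z, j) :=
          ⟨fun e => by rw [← D.arc_arc h, e, hij], fun e => by rw [e, hji]⟩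
        have e2 : D.arc h = (z, j) ↔ h = (y, i) :=
          ⟨fun e => by rw [← D.arc_arc h, e, hji], fun e => by rw [e, hij]⟩
        simp only [ψ, Pi.add_apply, Pi.single_apply, e1, e2]
        exact add_comm _ _
      have hsum : ∀ (w : X) (k : Fin 4) (x : X),
          ∑ i, (Pi.single (w, k) 1 : X × Fin 4 → ZMod 2) (x, i) = δ w x := by
        intro w k x
        simp only [Pi.single_apply, Prod.mk.injEq, δ]
        by_cases hx : x = w <;> simp [hx]
      have hbd : D.boundary ⟨ψ, hψ⟩ = δ y + δ z := by
        ext x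
        simp only [boundary_apply, ψ, Pi.add_apply, Finset.sum_add_distrib, hsum]
      have hz : δ z = D.boundary ⟨ψ, hψ⟩ - δ y := by rw [hbd]; abel
      rw [hz]
      exact sub_mem (Submodule.mem_sup_left ⟨_, rfl⟩) ih
  have htop : LinearMap.range D.boundary ⊔ Submodule.span (ZMod 2) {δ x₀} = ⊤ := by
    rw [eq_top_iff, ← (Pi.basisFun (ZMod 2) X).span_eq, Submodule.span_le]
    rintro _ ⟨x, rfl⟩
    simpa [δ] using hδ x
  have h1 := Submodule.finrank_add_le_finrank_add_finrank (LinearMap.range D.boundary)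
    (Submodule.span (ZMod 2) {δ x₀})
  have h2 : Module.finrank (ZMod 2) (Submodule.span (ZMod 2) {δ x₀}) ≤ 1 := by
    simpa using finrank_span_le_card (R := ZMod 2) ({δ x₀} : Set (X → ZMod 2))
  rw [htop, finrank_top, Module.finrank_pi] at h1
  omega

lemma finrank_ker_regionBoundary_le [Finite X]
    (hconn : ∀ x y, Relation.ReflTransGen D.Adj x y) :
    Module.finrank (ZMod 2) (LinearMap.ker D.regionBoundary) ≤ 1 := by
  have hle : LinearMap.ker D.regionBoundary ≤
      Submodule.span (ZMod 2) {(fun _ => 1 : D.Region → ZMod 2)} := by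
    intro c hc
    rw [LinearMap.mem_ker, Subtype.ext_iff, funext_iff] at hc
    have hconst := D.eq_of_constant_across_arcs hconn c fun x i => by
      have := hc (x, i)
      rwa [regionBoundary_apply, Submodule.coe_zero, Pi.zero_apply, CharTwo.add_eq_zero] at this
    rw [Submodule.mem_span_singleton]
    rcases isEmpty_or_nonempty D.Region with _ | ⟨⟨r⟩⟩
    · exact ⟨0, Subsingleton.elim _ _⟩
    · exact ⟨c r, by ext s; simp [hconst r s]⟩
  refine (Submodule.finrank_mono hle).trans ?_
  simpa using finrank_span_le_card (R := ZMod 2) {(fun _ => 1 : D.Region → ZMod 2)}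

end PDCode

namespace LinkDiagram

variable {X : Type*} (D : LinkDiagram X)

/-- A connected link diagram has no homology modulo 2 in degree one: every 1-cycle bounds
a set of regions. -/
theorem exists_regions_of_cycle [Finite X] [Nonempty X] (hconn : D.IsConnected)
    (ψ : X × Fin 4 → ZMod 2) (harc : ∀ h, ψ (D.arc h) = ψ h) (hsum : ∀ x, ∑ i, ψ (x, i) = 0) :
    ∃ c : D.Region → ZMod 2, ∀ x i,
      ψ (x, i) = c (D.region (x, i)) + c (D.region (x, i - 1)) := by
  cases nonempty_fintype X
  cases nonempty_fintype D.Region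
  have hcomp : Nat.card D.Component = 1 := by
    obtain ⟨x₀⟩ := ‹Nonempty X›
    rw [Nat.card_eq_one_iff_unique]
    refine ⟨⟨fun a b => ?_⟩, ⟨Quot.mk _ x₀⟩⟩
    induction a using Quot.inductionOn with | _ x =>
    induction b using Quot.inductionOn with | _ y =>
    induction hconn x y with
    | refl => rfl
    | tail _ hyz ih => exact ih.trans (Quot.sound hyz)
  have hplanar := D.planar
  rw [hcomp, Nat.card_eq_fintype_card, Nat.card_eq_fintype_card] at hplanar
  have h1 := D.finrank_ker_arcSum_le
  have h2 := D.card_le_finrank_range_boundary hconn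
  have h3 := D.finrank_ker_regionBoundary_le hconn
  have h4 := LinearMap.finrank_range_add_finrank_ker D.boundary
  have h5 := LinearMap.finrank_range_add_finrank_ker D.regionBoundary
  rw [Module.finrank_pi] at h5
  -- Cycles have dimension at most `2|X| - (|X| - 1) = |X| + 1`, boundaries at least `(|X| + 2) -
  -- 1`.
  have heq := Submodule.eq_of_le_of_finrank_le D.range_regionBoundary_le (by omega)
  have hψ : (⟨ψ, D.mem_ker_arcSum.2 harc⟩ : LinearMap.ker D.arcSum) ∈
      LinearMap.ker D.boundary := funext hsum
  rw [← heq] at hψ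
  obtain ⟨c, hc⟩ := hψ
  exact ⟨c, fun x i => (congrFun (congrArg Subtype.val hc) (x, i)).symm⟩

end LinkDiagram

lemma fin_four_eq_cases (i j : Fin 4) : j = i ∨ j = i + 1 ∨ j = i + 2 ∨ j = i - 1 := by
  decide +revert

/-! ### State circles and adequacy -/

namespace LinkDiagram

variable {X : Type*} {D : LinkDiagram X}

lemma partner_partner (ρ : Resolution) (i : Fin 4) : ρ.partner (ρ.partner i) = i := by
  cases ρ <;> fin_cases i <;> rfl

lemma partner_add_two {ρ : Resolution} {i : Fin 4} (h : ρ.partner i = i + 1) :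
    ρ.partner (i + 2) = i + 3 := by
  revert h
  cases ρ <;> fin_cases i <;> decide

lemma stateCircle_arc (σ : D.State) (h : X × Fin 4) :
    D.stateCircle σ (D.arc h) = D.stateCircle σ h :=
  (Quot.sound (r := fun h k : X × Fin 4 => k = D.arc h ∨ k = (h.1, (σ h.1).partner h.2))
    (Or.inl rfl)).symm

lemma stateCircle_partner (σ : D.State) (x : X) {i j : Fin 4} (h : (σ x).partner i = j) :
    D.stateCircle σ (x, j) = D.stateCircle σ (x, i) :=
  (Quot.sound (r := fun h k : X × Fin 4 => k = D.arc h ∨ k = (h.1, (σ h.1).partner h.2))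
    (Or.inr (by rw [← h]))).symm

lemma IsAdequate.stateCircle_ne {σ : D.State} (hσ : D.IsAdequate σ) (x : X) (i : Fin 4) :
    D.stateCircle σ (x, i) ≠ D.stateCircle σ (x, i + 2) := by
  have h02 := hσ x
  have h13 : D.stateCircle σ (x, 1) ≠ D.stateCircle σ (x, 3) := by
    cases hx : σ x with
    | A =>
      rw [stateCircle_partner σ x (i := 0) (j := 1) (by rw [hx]; rfl),
        stateCircle_partner σ x (i := 2) (j := 3) (by rw [hx]; rfl)]
      exact h02
    | B =>
      rw [stateCircle_partner σ x (i := 2) (j := 1) (by rw [hx]; rfl),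
        stateCircle_partner σ x (i := 0) (j := 3) (by rw [hx]; rfl)]
      exact h02.symm
  fin_cases i
  · exact h02
  · exact h13
  · exact h02.symm
  · exact h13.symm

open Classical in
/-- In a connected diagram, a state circle separates the regions: there is a function of the
regions that changes across exactly the arcs on the state circle. -/
lemma exists_regions_of_stateCircle [Finite X] [Nonempty X] (hconn : D.IsConnected)
    (σ : D.State) (a : D.StateCircle σ) :
    ∃ c : D.Region → ZMod 2, ∀ x i,
      (if D.stateCircle σ (x, i) = a then 1 else 0) =
        c (D.region (x, i)) + c (D.region (x, i - 1)) := by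
  refine D.exists_regions_of_cycle hconn (fun h => if D.stateCircle σ h = a then 1 else 0)
    (fun h => by rw [stateCircle_arc]) fun x => ?_
  rw [Fin.sum_univ_four]
  cases hx : σ x with
  | A =>
    rw [stateCircle_partner σ x (i := 0) (j := 1) (by rw [hx]; rfl),
      stateCircle_partner σ x (i := 2) (j := 3) (by rw [hx]; rfl), CharTwo.add_self_eq_zero,
      zero_add, CharTwo.add_self_eq_zero]
  | B =>
    rw [stateCircle_partner σ x (i := 2) (j := 1) (by rw [hx]; rfl),
      stateCircle_partner σ x (i := 0) (j := 3) (by rw [hx]; rfl), add_assoc, add_assoc,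
      ← add_assoc _ _ (ite _ _ _), CharTwo.add_self_eq_zero, zero_add, CharTwo.add_self_eq_zero]

/-- Let `x` be a crossing and `j` a corner at which an adequate state joins the two half-edges.
Then there is a function of the regions that takes different values at the corners `j`
and `j + 2` of `x`, but equal values at opposite corners of every crossing which are merged by
the state. -/
lemma IsAdequate.exists_regions [Finite X] [Nonempty X] (hconn : D.IsConnected) {σ : D.State}
    (hσ : D.IsAdequate σ) {x : X} {j : Fin 4} (hj : (σ x).partner j = j + 1) :
    ∃ c : D.Region → ZMod 2, c (D.region (x, j)) + c (D.region (x, j + 2)) = 1 ∧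
      ∀ y i, (σ y).partner (i + 1) = i + 2 →
        c (D.region (y, i)) + c (D.region (y, i + 2)) = 0 := by
  classical
  -- The circle through the arc at corner `j` of `x`; adequacy keeps it off the opposite arc, which
  -- contains `j + 2`.
  obtain ⟨c, hc⟩ := exists_regions_of_stateCircle hconn σ (D.stateCircle σ (x, j + 1))
  have hdiff : ∀ y i, c (D.region (y, i)) + c (D.region (y, i + 2)) =
      (if D.stateCircle σ (y, i + 1) = D.stateCircle σ (x, j + 1) then 1 else 0) +
      (if D.stateCircle σ (y, i + 2) = D.stateCircle σ (x, j + 1) then 1 else 0) := by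
    intro y i
    rw [hc, hc, add_sub_cancel_right, (by decide : ∀ i : Fin 4, i + 2 - 1 = i + 1) i]
    linear_combination (-CharTwo.add_self_eq_zero (c (D.region (y, i + 1))))
  refine ⟨c, ?_, fun y i hi => ?_⟩
  · have hne := hσ.stateCircle_ne x (j + 1)
    have h3 : D.stateCircle σ (x, j + 1 + 2) = D.stateCircle σ (x, j + 2) := by
      rw [(by decide : ∀ i : Fin 4, i + 1 + 2 = i + 3) (j)]
      exact stateCircle_partner σ x (partner_add_two hj)
    rw [h3] at hne
    rw [hdiff, if_pos rfl, if_neg hne.symm, add_zero]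
  · rw [hdiff, stateCircle_partner σ y hi, CharTwo.add_self_eq_zero]

/-! ### Checkerboard states and the Tait graph -/

namespace Checkerboard

variable (C : D.Checkerboard)

lemma isBlack_add_two (x : X) (i : Fin 4) :
    C.isBlack (D.region (x, i + 2)) = C.isBlack (D.region (x, i)) := by
  rw [(by decide : ∀ i : Fin 4, i + 2 = i + 1 + 1) i, C.alternates, C.alternates, Bool.not_not]

lemma isBlack_sub_one (x : X) (i : Fin 4) :
    C.isBlack (D.region (x, i - 1)) = !C.isBlack (D.region (x, i)) := by
  have := C.alternates x (i - 1)
  rw [sub_add_cancel] at this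
  rw [this, Bool.not_not]

lemma exists_isBlack (x : X) : ∃ i, C.isBlack (D.region (x, i)) = true := by
  by_cases h : C.isBlack (D.region (x, 0)) = true
  · exact ⟨0, h⟩
  · exact ⟨0 + 1, by rw [C.alternates]; simpa using h⟩

/-- The checkerboard coloring with the opposite colors. -/
def swap : D.Checkerboard where
  isBlack r := !C.isBlack r
  alternates x i := by rw [C.alternates]

lemma blackState_swap : C.swap.blackState = C.whiteState := by
  funext x
  by_cases h : C.isBlack (D.region (x, 0)) <;> simp [blackState, whiteState, swap, h]

lemma blackState_ne_whiteState (x : X) : C.blackState x ≠ C.whiteState x := by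
  by_cases h : C.isBlack (D.region (x, 0)) <;> simp [blackState, whiteState, h]

lemma partner_blackState {x : X} {i : Fin 4} (h : C.isBlack (D.region (x, i)) = true) :
    (C.blackState x).partner i = i + 1 := by
  have h1 := C.alternates x 0
  have h2 := C.isBlack_add_two x 0
  have h3 := C.isBlack_add_two x 1
  by_cases h0 : C.isBlack (D.region (x, 0)) = true
  · rw [blackState, if_pos h0]
    fin_cases i <;> simp_all <;> rfl
  · rw [blackState, if_neg h0]
    fin_cases i <;> simp_all <;> rfl

lemma partner_of_ne_blackState {σ : D.State} {x : X} {i : Fin 4} (hσ : σ x ≠ C.blackState x)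
    (h : C.isBlack (D.region (x, i)) = true) : (σ x).partner (i + 1) = i + 2 := by
  have := C.partner_blackState h
  revert hσ this
  generalize C.blackState x = ρ
  generalize σ x = τ
  cases ρ <;> cases τ <;> fin_cases i <;> simp <;> decide

/-- The black checkerboard state of a reduced diagram is adequate: its state circles
run along the boundaries of black regions, and the two black regions at a crossing are distinct. -/
lemma isAdequate_blackState (hred : D.IsReduced) : D.IsAdequate C.blackState := by
  -- The black region beside a half-edge is constant along each state circle.
  let f : X × Fin 4 → D.Region := fun h =>
    if C.isBlack (D.region h) then D.region h else D.region (h.1, h.2 - 1)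
  have hf : ∀ x i, C.isBlack (D.region (x, i)) = true →
      f (x, i) = D.region (x, i) ∧ f (x, i + 1) = D.region (x, i) := by
    intro x i h
    refine ⟨if_pos h, ?_⟩
    simp only [f]
    rw [if_neg (by simp [C.alternates, h]), add_sub_cancel_right]
  have harc : ∀ h, f (D.arc h) = f h := by
    intro h
    simp only [f, D.region_arc, C.isBlack_sub_one, ← D.region_eq_arc]
    by_cases hb : C.isBlack (D.region h) = true <;> simp [hb]
  have hpartner : ∀ x i, f (x, (C.blackState x).partner i) = f (x, i) := by
    intro x i
    by_cases hb : C.isBlack (D.region (x, i)) = true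
    · rw [C.partner_blackState hb, (hf x i hb).1, (hf x i hb).2]
    · have hb' : C.isBlack (D.region (x, i - 1)) = true := by
        rw [C.isBlack_sub_one]; simpa using hb
      have h1 := C.partner_blackState hb'
      rw [sub_add_cancel] at h1
      have h2 := hf x _ hb'
      rw [sub_add_cancel] at h2
      rw [← h1, partner_partner, h2.1, h1, h2.2]
  let F : D.StateCircle C.blackState → D.Region := Quot.lift f (by
    rintro h k (rfl | rfl)
    · exact (harc h).symm
    · exact (hpartner h.1 h.2).symm)
  intro x hx
  have hx' : f (x, 0) = f (x, 2) := congrArg F hx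
  have h2 := C.isBlack_add_two x 0
  rw [zero_add] at h2
  simp only [f, h2] at hx'
  split_ifs at hx'
  · exact hred x ⟨0, 2, by decide, hx'⟩
  · exact hred x ⟨0 - 1, 2 - 1, by decide, hx'⟩

lemma isAdequate_whiteState (hred : D.IsReduced) : D.IsAdequate C.whiteState :=
  C.blackState_swap ▸ C.swap.isAdequate_blackState hred

lemma isLink_taitGraph {x : X} {i : Fin 4} (h : C.isBlack (D.region (x, i)) = true) :
    C.taitGraph.IsLink x (D.region (x, i)) (D.region (x, i + 2)) := ⟨i, h, rfl, rfl⟩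

lemma edgeSet_taitGraph : C.taitGraph.edgeSet = Set.univ :=
  Set.eq_univ_of_forall fun x =>
    let ⟨_, hi⟩ := C.exists_isBlack x
    (C.isLink_taitGraph hi).edge_mem

lemma isConnected_taitGraph [Nonempty X] (hconn : D.IsConnected) : C.taitGraph.IsConnected := by
  let R := Relation.ReflTransGen fun a b => ∃ e, C.taitGraph.IsLink e a b
  have hsame : ∀ x i j, C.isBlack (D.region (x, i)) = true → C.isBlack (D.region (x, j)) = true →
      R (D.region (x, i)) (D.region (x, j)) := by
    intro x i j hi hj
    have hij : j = i ∨ j = i + 1 ∨ j = i + 2 ∨ j = i - 1 :=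
      fin_four_eq_cases i j
    rcases hij with rfl | rfl | rfl | rfl
    · exact .refl
    · simp [C.alternates, hi] at hj
    · exact .single ⟨x, C.isLink_taitGraph hi⟩
    · simp [C.isBlack_sub_one, hi] at hj
  have hreach : ∀ x y i j, C.isBlack (D.region (x, i)) = true →
      C.isBlack (D.region (y, j)) = true → R (D.region (x, i)) (D.region (y, j)) := by
    intro x y i j hi hj
    have h := hconn x y
    induction h generalizing j with
    | refl => exact hsame x i j hi hj
    | @tail y z _ hyz ih =>
      obtain ⟨k, l, hkl⟩ := hyz
      by_cases hk : C.isBlack (D.region (y, k)) = true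
      · have hr := D.region_eq_arc (y, k)
        rw [hkl] at hr
        exact (ih k hk).trans (hr ▸ hsame z (l - 1) j (hr ▸ hk) hj)
      · have hk' : C.isBlack (D.region (y, k - 1)) = true := by
          rw [C.isBlack_sub_one]; simpa using hk
        have hr := D.region_arc (y, k)
        rw [hkl] at hr
        exact (ih (k - 1) hk').trans (hr ▸ hsame z l j (hr ▸ hk') hj)
  refine ⟨?_, fun r hr s hs => ?_⟩
  · obtain ⟨x₀⟩ := ‹Nonempty X›
    obtain ⟨i, hi⟩ := C.exists_isBlack x₀
    exact ⟨D.region (x₀, i), hi⟩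
  · induction r using Quotient.inductionOn with | _ p =>
    induction s using Quotient.inductionOn with | _ q =>
    exact hreach p.1 q.1 p.2 q.2 hr hs

/-- For every function of the regions, the crossings at which it takes different values on
the two white corners form a cycle of the Tait graph modulo 2. -/
lemma sum_smul_incVec [Fintype X] (c : D.Region → ZMod 2) (κ : X → ZMod 2)
    (hκ : ∀ x i, C.isBlack (D.region (x, i)) = true →
      κ x = c (D.region (x, i + 1)) + c (D.region (x, i + 1 + 2))) :
    ∑ x, κ x • C.taitGraph.incVec x = 0 := by
  classical
  let w : D.Region → D.Region →₀ ZMod 2 := fun r =>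
    if C.isBlack r then Finsupp.single r 1 else 0
  have hterm : ∀ x, κ x • C.taitGraph.incVec x =
      ∑ i, (c (D.region (x, i + 1)) + c (D.region (x, i - 1))) • w (D.region (x, i)) := by
    intro x
    obtain ⟨i, hi⟩ := C.exists_isBlack x
    rw [(C.isLink_taitGraph hi).incVec_eq, hκ x i hi, ← Equiv.sum_comp (Equiv.addLeft i),
      Fin.sum_univ_four]
    have e3 : (3 : Fin 4) = 1 + 2 := rfl
    have h2 := C.isBlack_add_two x i
    have h1 := C.alternates x i
    have h3 := C.isBlack_add_two x (i + 1)
    have a1 : i + 2 + 1 = i + 1 + 2 := add_right_comm _ _ _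
    have a2 : i + 2 - 1 = i + 1 := (by decide : ∀ i : Fin 4, i + 2 - 1 = i + 1) i
    have a3 : i - 1 = i + 1 + 2 := (by decide : ∀ i : Fin 4, i - 1 = i + 1 + 2) i
    simp only [Equiv.coe_addLeft, add_zero, e3, ← add_assoc, w, h1, h2, h3, hi, a1, a2, a3,
      if_true, Bool.not_true, Bool.false_eq_true, if_false, smul_zero, smul_add]
    rw [add_comm (c (D.region (x, i + 1 + 2)))]
  simp_rw [hterm]
  rw [← Fintype.sum_prod_type'
    (fun x i => (c (D.region (x, i + 1)) + c (D.region (x, i - 1))) • w (D.region (x, i)))]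
  simp_rw [add_smul, Finset.sum_add_distrib]
  -- Walking around a region, the neighbor across the arc leaving one corner is the neighbor across
  -- the arc entering the next, so each contribution occurs twice.
  have hturn : ∑ p : X × Fin 4, c (D.region (p.1, p.2 - 1)) • w (D.region (p.1, p.2)) =
      ∑ p : X × Fin 4, c (D.region (p.1, p.2 + 1)) • w (D.region (p.1, p.2)) := by
    rw [← Equiv.sum_comp D.turn
      fun p : X × Fin 4 => c (D.region (p.1, p.2 + 1)) • w (D.region (p.1, p.2))]
    refine Finset.sum_congr rfl fun p _ => ?_
    have h1 : D.region ((D.turn p).1, (D.turn p).2) = D.region (p.1, p.2) := D.region_turn p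
    have h2 : D.region ((D.turn p).1, (D.turn p).2 + 1) = D.region (p.1, p.2 - 1) := by
      rw [← D.region_arc]
      simp [PDCode.turn]
    rw [h1, h2]
  rw [hturn]
  exact ZModModule.add_self _

end Checkerboard

/-- The crossings at which an adequate state merges the black corners form a cyclic flat of
the Tait graph. -/
theorem IsAdequate.isCyclicFlat [Finite X] [Nonempty X] (hconn : D.IsConnected)
    (C : D.Checkerboard) {σ : D.State} (hσ : D.IsAdequate σ) :
    IsCyclicFlat (ZMod 2) C.taitGraph.incVec {x | σ x ≠ C.blackState x} := by
  classical
  cases nonempty_fintype X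
  refine ⟨fun e he => ?_, fun e he hspan => ?_⟩
  · obtain ⟨i, hi⟩ := C.exists_isBlack e
    have hpart : (σ e).partner (i + 1) = i + 1 + 1 := by
      rw [C.partner_of_ne_blackState he hi, add_assoc]; rfl
    obtain ⟨c, hc, hc'⟩ := hσ.exists_regions hconn hpart
    choose k hk using C.exists_isBlack
    -- `κ` marks the dual cut: the crossings whose two white corners get different values of `c`.
    let κ : X → ZMod 2 := fun x => c (D.region (x, k x + 1)) + c (D.region (x, k x + 1 + 2))
    have hκ : ∀ x i, C.isBlack (D.region (x, i)) = true →
        κ x = c (D.region (x, i + 1)) + c (D.region (x, i + 1 + 2)) := by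
      intro x i hi
      have hki := hk x
      have hij : k x = i ∨ k x = i + 1 ∨ k x = i + 2 ∨ k x = i - 1 :=
        fin_four_eq_cases i (k x)
      rcases hij with h | h | h | h
      · simp only [κ, h]
      · rw [h, C.alternates, hi] at hki; simp at hki
      · simp only [κ, h]
        rw [(by decide : ∀ i : Fin 4, i + 2 + 1 + 2 = i + 1) i,
          add_right_comm i 2 1, add_comm]
      · rw [h, C.isBlack_sub_one, hi] at hki; simp at hki
    have hsum := C.sum_smul_incVec c κ hκ
    rw [← Finset.add_sum_erase _ _ (Finset.mem_univ e), hκ e i hi, hc, one_smul,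
      ← ZModModule.sub_eq_add, sub_eq_zero] at hsum
    rw [hsum]
    refine sum_mem fun x hx => ?_
    by_cases hxS : σ x ≠ C.blackState x
    · exact Submodule.smul_mem _ _
        (Submodule.subset_span ⟨x, ⟨hxS, (Finset.mem_erase.1 hx).1⟩, rfl⟩)
    -- Outside the set the state is black and merges the white corners, so `κ` vanishes there.
    · have hp : (σ x).partner (k x + 1 + 1) = k x + 1 + 2 := by
        rw [not_not.1 hxS, add_assoc, add_assoc]
        exact partner_add_two (C.partner_blackState (hk x))
      have h0 : κ x = 0 := hc' x _ hp
      rw [h0, zero_smul]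
      exact zero_mem _
  · have he' : σ e = C.blackState e := not_not.1 he
    obtain ⟨i, hi⟩ := C.exists_isBlack e
    obtain ⟨c, hc, hc'⟩ := hσ.exists_regions hconn (he' ▸ C.partner_blackState hi)
    -- As a functional, `c` kills every crossing of the set, whose black corners are merged, but not
    -- `e`.
    have hker : C.taitGraph.incVec e ∈ LinearMap.ker (Finsupp.linearCombination (ZMod 2) c) := by
      refine Submodule.span_le.2 ?_ hspan
      rintro _ ⟨x, hx, rfl⟩
      obtain ⟨j, hj⟩ := C.exists_isBlack x
      rw [SetLike.mem_coe, LinearMap.mem_ker,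
        (C.isLink_taitGraph hj).linearCombination_incVec]
      exact hc' x j (C.partner_of_ne_blackState hx hj)
    rw [LinearMap.mem_ker, (C.isLink_taitGraph hi).linearCombination_incVec, hc] at hker
    exact one_ne_zero hker

lemma eq_of_setOf_ne_eq {σ τ υ : D.State} (h : {x | σ x ≠ υ x} = {x | τ x ≠ υ x}) : σ = τ := by
  funext x
  have hx : σ x ≠ υ x ↔ τ x ≠ υ x := Set.ext_iff.1 h x
  revert hx
  cases σ x <;> cases τ x <;> cases υ x <;> simp

end LinkDiagram

theorem theorem1p4 {X : Type*} [Finite X] [Nonempty X] (D : LinkDiagram X)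
    (hconn : D.IsConnected) (hred : D.IsReduced) (C : D.Checkerboard) :
    D.IsAdequate C.blackState ∧ D.IsAdequate C.whiteState ∧
      2 ≤ {σ : D.State | D.IsAdequate σ}.ncard ∧
      {σ : D.State | D.IsAdequate σ}.ncard ≤ C.taitGraph.spanningTrees.ncard := by
  have hb := C.isAdequate_blackState hred
  have hw := C.isAdequate_whiteState hred
  obtain ⟨F, hF, hinj⟩ := exists_injOn_cyclicFlats (K := ZMod 2) C.taitGraph.incVec
  have hmaps : ∀ σ ∈ {σ : D.State | D.IsAdequate σ},
      C.taitGraph.restrict (F {x | σ x ≠ C.blackState x}) ∈ C.taitGraph.spanningTrees :=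
    fun σ hσ => (C.isConnected_taitGraph hconn).restrict_mem_spanningTrees
      (hF _ (LinkDiagram.IsAdequate.isCyclicFlat hconn C hσ))
  have hinj' : Set.InjOn
      (fun σ : D.State => C.taitGraph.restrict (F {x | σ x ≠ C.blackState x}))
      {σ : D.State | D.IsAdequate σ} := by
    intro σ hσ τ hτ h
    -- Every crossing is an edge, so the tree's edge set recovers the basis exactly.
    have hE := congrArg Graph.edgeSet h
    simp only [Graph.edgeSet_restrict, C.edgeSet_taitGraph, Set.univ_inter] at hE
    exact LinkDiagram.eq_of_setOf_ne_eq (hinj (LinkDiagram.IsAdequate.isCyclicFlat hconn C hσ)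
      (LinkDiagram.IsAdequate.isCyclicFlat hconn C hτ) hE)
  have hfin := C.taitGraph.finite_spanningTrees
  refine ⟨hb, hw, ?_, Set.ncard_le_ncard_of_injOn _ hmaps hinj' hfin⟩
  obtain ⟨x₀⟩ := ‹Nonempty X›
  rw [Nat.succ_le_iff, Set.one_lt_ncard_iff (hfin.of_injOn hmaps hinj')]
  exact ⟨_, _, hb, hw, fun h => C.blackState_ne_whiteState x₀ (congrFun h x₀)⟩
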